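/- \textbf{Theorem (Goldberg coefficients).} Let $a_1,\dots,a_n$ be distinct letters of an alphabet $\mathfrak A$, and expand $$\log(e^{a_1}e^{a_2}\cdots e^{a_n})$$ in the ring of formal power series over $\mathbb C$ in the noncommuting letters of $\mathfrak A$, where $e^{f}=\sum_{k\ge 0} f^k/k!$ and $\log f=\sum_{k\ge 1}\frac{(-1)^{k-1}}{k}(f-1)^k$. Let $m\ge 1$, let $\underline i=(i_1,\dots,i_m)$ with $i_j\in\{1,\dots,n\}$ and $i_j\ne i_{j+1}$ for $1\le j\le m-1$, and let $q_1,\dots,q_m\ge 1$ be integers. Then the coefficient of the word $a_{i_1}^{q_1}a_{i_2}^{q_2}\cdots a_{i_m}^{q_m}$ in this series equals $$\frac{1}{q_1!\,q_2!\cdots q_m!}\int_{-1}^0 x^{\operatorname{des}(\underline i)}(1+x)^{\operatorname{asc}(\underline i)}\prod_{j=1}^m P_{q_j}(x)\,dx .$$ Here $\operatorname{des}(\underline i)$ and $\operatorname{asc}(\underline i)$ are the numbers of indices $1\le j\le m-1$ with $i_j>i_{j+1}$ and with $i_j<i_{j+1}$, respectively, and for $q\ge 1$ $$P_q(x)=\sum_{k=1}^q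 k!\,S(q,k)\,x^{k-1}=E_q(x,x+1),$$ where $S(q,k)$ are the Stirling numbers of the second kind and $E_q(x,y)=\sum_{\sigma\in\mathfrak S_q}x^{\operatorname{des}\sigma}y^{\operatorname{asc}\sigma}$ is the homogeneous Eulerian polynomial, with $\operatorname{des}\sigma$ and $\operatorname{asc}\sigma$ the numbers of descents and ascents of the sequence $\sigma(1),\dots,\sigma(q)$. -/

import Mathlib

open scoped Nat

noncomputable section

/-- Formal power series in the noncommuting letters of `A`, with coefficients in `R`:
all (not only finitely supported) functions from words to `R`. -/
def NCSeries (A R : Type*) := FreeMonoid A → R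

namespace NCSeries

variable {A R : Type*}

/-- The coefficient of the word `w` in the series `f`. -/
def coeff (w : FreeMonoid A) (f : NCSeries A R) : R := f w

@[ext] theorem ext {f g : NCSeries A R} (h : ∀ w, coeff w f = coeff w g) : f = g := funext h

instance [AddCommGroup R] : AddCommGroup (NCSeries A R) :=
  inferInstanceAs (AddCommGroup (FreeMonoid A → R))

/-- The constant series `1`, i.e. the empty word. -/
instance [Zero R] [One R] : One (NCSeries A R) :=
  ⟨fun w => if w.toList = [] then 1 else 0⟩

/-- The Cauchy product: the coefficient of `w` in `f * g` is the sum of `f u * g v` over all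
factorizations `w = u v` of `w` into a prefix and the complementary suffix. -/
instance [Ring R] : Mul (NCSeries A R) :=
  ⟨fun f g w => ∑ k ∈ Finset.range (w.toList.length + 1),
    coeff (FreeMonoid.ofList (w.toList.take k)) f * coeff (FreeMonoid.ofList (w.toList.drop k)) g⟩

/-- The series whose coefficient at `w` is the coefficient of `f` at `a w`. -/
def tail (a : A) (f : NCSeries A R) : NCSeries A R :=
  fun w => coeff (FreeMonoid.of a * w) f

theorem coeff_tail (a : A) (f : NCSeries A R) (w : FreeMonoid A) :
    coeff w (tail a f) = coeff (FreeMonoid.of a * w) f := rfl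

section Ring

variable [Ring R]

theorem coeff_zero (w : FreeMonoid A) : coeff w (0 : NCSeries A R) = 0 := rfl

theorem coeff_add (w : FreeMonoid A) (f g : NCSeries A R) :
    coeff w (f + g) = coeff w f + coeff w g := rfl

open Classical in
theorem coeff_one (w : FreeMonoid A) :
    coeff w (1 : NCSeries A R) = if w = 1 then 1 else 0 := by
  have h : (w.toList = []) ↔ w = 1 := Iff.rfl
  change (if w.toList = [] then (1 : R) else 0) = _
  simp only [h]

theorem coeff_mul (w : FreeMonoid A) (f g : NCSeries A R) :
    coeff w (f * g) = ∑ k ∈ Finset.range (w.toList.length + 1),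
      coeff (FreeMonoid.ofList (w.toList.take k)) f *
        coeff (FreeMonoid.ofList (w.toList.drop k)) g := rfl

theorem coeff_empty_mul (f g : NCSeries A R) :
    coeff 1 (f * g) = coeff 1 f * coeff 1 g := by
  rw [coeff_mul]
  exact Finset.sum_range_one (fun k => coeff (FreeMonoid.ofList (List.take k [])) f *
    coeff (FreeMonoid.ofList (List.drop k [])) g)

theorem coeff_of_mul_mul (a : A) (w : FreeMonoid A) (f g : NCSeries A R) :
    coeff (FreeMonoid.of a * w) (f * g) =
      coeff 1 f * coeff (FreeMonoid.of a * w) g + coeff w (tail a f * g) := by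
  rw [coeff_mul, coeff_mul, add_comm (coeff 1 f * _)]
  exact Finset.sum_range_succ' (fun k =>
    coeff (FreeMonoid.ofList ((a :: w.toList).take k)) f *
      coeff (FreeMonoid.ofList ((a :: w.toList).drop k)) g) (w.toList.length + 1)

theorem right_distrib' (f g h : NCSeries A R) : (f + g) * h = f * h + g * h := by
  ext w
  simp only [coeff_mul, coeff_add, add_mul, Finset.sum_add_distrib]

theorem left_distrib' (f g h : NCSeries A R) : f * (g + h) = f * g + f * h := by
  ext w
  simp only [coeff_mul, coeff_add, mul_add, Finset.sum_add_distrib]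

theorem mul_assoc' (f g h : NCSeries A R) : f * g * h = f * (g * h) := by
  ext w
  induction w using FreeMonoid.inductionOn' generalizing f g h with
  | one => simp only [coeff_empty_mul, mul_assoc]
  | of_mul a w ih =>
    have key : coeff w (tail a (f * g) * h) =
        coeff 1 f * coeff w (tail a g * h) + coeff w (tail a f * g * h) := by
      simp only [coeff_mul w, Finset.mul_sum, ← Finset.sum_add_distrib, coeff_tail,
        coeff_of_mul_mul, add_mul, mul_assoc]
    rw [coeff_of_mul_mul, coeff_of_mul_mul a w f, coeff_of_mul_mul a w g, key, ih,
      coeff_empty_mul, mul_add, mul_assoc, add_assoc]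

theorem one_mul' (f : NCSeries A R) : 1 * f = f := by
  ext w
  rw [coeff_mul, Finset.sum_eq_single 0]
  · have : coeff (FreeMonoid.ofList (w.toList.take 0)) (1 : NCSeries A R) = 1 := rfl
    rw [this, one_mul]; rfl
  · intro k hk hk0
    have : coeff (FreeMonoid.ofList (w.toList.take k)) (1 : NCSeries A R) = 0 := by
      refine if_neg ?_
      intro h
      have h' := congrArg List.length h
      simp only [FreeMonoid.toList_ofList, List.length_take, List.length_nil] at h'
      simp only [Finset.mem_range] at hk
      omega
    rw [this, zero_mul]
  · simp

theorem mul_one' (f : NCSeries A R) : f * 1 = f := by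
  ext w
  rw [coeff_mul, Finset.sum_eq_single w.toList.length]
  · have : coeff (FreeMonoid.ofList (w.toList.drop w.toList.length)) (1 : NCSeries A R) = 1 := by
      refine if_pos ?_
      simp
    rw [this, mul_one, List.take_length]; rfl
  · intro k hk hk0
    have : coeff (FreeMonoid.ofList (w.toList.drop k)) (1 : NCSeries A R) = 0 := by
      refine if_neg ?_
      intro h
      have h' := congrArg List.length h
      simp only [FreeMonoid.toList_ofList, List.length_drop, List.length_nil] at h'
      simp only [Finset.mem_range] at hk
      omega
    rw [this, mul_zero]
  · simp

instance : Ring (NCSeries A R) :=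
  { (inferInstance : AddCommGroup (NCSeries A R)) with
    mul := (· * ·)
    one := 1
    mul_assoc := mul_assoc'
    one_mul := one_mul'
    mul_one := mul_one'
    left_distrib := left_distrib'
    right_distrib := right_distrib'
    zero_mul := fun f => by ext w; simp [coeff_mul, coeff_zero]
    mul_zero := fun f => by ext w; simp [coeff_mul, coeff_zero] }

open Classical in
/-- The letter `a`, as a series. -/
def letter (R : Type*) [Ring R] (a : A) : NCSeries A R :=
  fun w => if w = FreeMonoid.of a then 1 else 0

end Ring

variable {K : Type*} [Field K]

/-- `exp f = ∑_{k ≥ 0} f ^ k / k!`, summed coefficientwise. For `f` without constant term, each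
coefficient is a sum with finitely many nonzero terms. -/
def exp (f : NCSeries A K) : NCSeries A K :=
  fun w => ∑ᶠ k : ℕ, (1 / (k ! : K)) * coeff w (f ^ k)

/-- `log f = ∑_{k ≥ 1} (-1) ^ (k - 1) / k * (f - 1) ^ k`, summed coefficientwise. For `f` with
constant term `1`, each coefficient is a sum with finitely many nonzero terms. -/
def log (f : NCSeries A K) : NCSeries A K :=
  fun w => ∑ᶠ k : ℕ, ((-1) ^ k / ((k : K) + 1)) * coeff w ((f - 1) ^ (k + 1))

end NCSeries

/-- The number of descents `i_j > i_{j+1}` of a finite sequence. -/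
def des {α : Type*} [LinearOrder α] {m : ℕ} (i : Fin m → α) : ℕ :=
  Nat.card {j : Fin m // ∃ h : (j : ℕ) + 1 < m, i ⟨j + 1, h⟩ < i j}

/-- The number of ascents `i_j < i_{j+1}` of a finite sequence. -/
def asc {α : Type*} [LinearOrder α] {m : ℕ} (i : Fin m → α) : ℕ :=
  Nat.card {j : Fin m // ∃ h : (j : ℕ) + 1 < m, i j < i ⟨j + 1, h⟩}

/-- The homogeneous Eulerian polynomial `E_q(x, y)`, the sum of `x ^ des σ * y ^ asc σ` over all
permutations `σ` of `q` points. -/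
def homEulerian (q : ℕ) (x y : ℝ) : ℝ :=
  ∑ σ : Equiv.Perm (Fin q), x ^ des σ * y ^ asc σ

/-- `P_q(x) = ∑_{k=1}^q k! S(q,k) x^{k-1}`, with `S` the Stirling numbers of the second kind. -/
def eulerP (q : ℕ) (x : ℝ) : ℝ :=
  ∑ k ∈ Finset.Icc 1 q, (k ! : ℝ) * (Nat.stirlingSecond q k : ℝ) * x ^ (k - 1)

end

/-! ### Stirling numbers and the polynomials `eulerP` -/

/-! Let `f` be the product of the exponentials and `H = ∑ x^k (f - 1)^k` its resolvent. Since
`∫_{-1}^0 x^k dx = (-1)^k / (k + 1)`, a nonconstant coefficient of `log f` is the integral of the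
corresponding coefficient of `H` divided by `x` (`coeff_log_eq_integral`). So it is enough to
compute `H`.

From `H = 1 + x (f - 1) H` one gets `x [w] f H = (1 + x) [w] H` for nonempty words `w`. Moreover,
multiplying on the left by `e^{a_k}` leaves the coefficient at `w` unchanged unless `w` begins with
`a_k` (`coeff_expTail_mul_congr`). For `w = a_j^s v`, with `v` not beginning with `a_j`, these facts
give a recursion in `s`, solved by `surjPoly s x / s!`. A block of length `q` is thus stripped at
the cost of `x * eulerP q x / q!`, leaving the coefficient at `v` of `e^{a_{j+1}} ⋯ e^{a_{n-1}} H`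
(`coeff_replicate_append_resolvent`).

If the next letter has a smaller index, all these exponentials can be dropped, and the factor `x`
remains. If it has a larger index, the missing exponentials can be put back to form `f H`, and `x`
becomes `1 + x`. Induction on the number of blocks finishes the computation.

The identity with Eulerian polynomials is separate: it refines the sum over permutations by first
value (`homEulerianFirst_eq`). -/

theorem Nat.stirlingSecond_succ_succ_eq_sum_choose (n k : ℕ) :
    Nat.stirlingSecond (n + 1) (k + 1) =
      ∑ i ∈ Finset.range (n + 1), n.choose i * Nat.stirlingSecond (n - i) k := by
  induction n generalizing k with
  | zero => cases k <;> simp [Nat.stirlingSecond]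
  | succ n ih =>
    have key : ∑ i ∈ Finset.range (n + 1 + 1),
          (n + 1).choose i * Nat.stirlingSecond (n + 1 - i) k =
        ∑ i ∈ Finset.range (n + 1), n.choose i * Nat.stirlingSecond (n - i) k +
        ∑ i ∈ Finset.range (n + 1), n.choose i * Nat.stirlingSecond (n - i + 1) k := by
      have h2 : ∑ i ∈ Finset.range (n + 1), n.choose i * Nat.stirlingSecond (n - i + 1) k =
          ∑ i ∈ Finset.range (n + 2), n.choose i * Nat.stirlingSecond (n + 1 - i) k := by
        rw [Finset.sum_range_succ _ (n + 1), Nat.choose_succ_self, zero_mul, add_zero]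
        refine Finset.sum_congr rfl fun i hi => ?_
        rw [Nat.sub_add_comm (Nat.lt_succ_iff.1 (Finset.mem_range.1 hi))]
      rw [h2, Finset.sum_range_succ', Finset.sum_range_succ' _ (n + 1), ← add_assoc,
        ← Finset.sum_add_distrib]
      simp [Nat.choose_succ_succ, add_mul]
    rw [key, Nat.stirlingSecond_succ_succ, ih]
    cases k with
    | zero => simp [Nat.stirlingSecond]
    | succ k =>
      rw [ih k]
      rw [Finset.mul_sum, ← Finset.sum_add_distrib, ← Finset.sum_add_distrib]
      refine Finset.sum_congr rfl fun i _ => ?_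
      rw [Nat.stirlingSecond_succ_succ]
      ring

/-- Counts partitions with one marked block, by the size `i + 1` of that block. -/
theorem Nat.succ_mul_stirlingSecond_succ (n k : ℕ) :
    (k + 1) * Nat.stirlingSecond (n + 1) (k + 1) =
      ∑ i ∈ Finset.range (n + 1), (n + 1).choose (i + 1) * Nat.stirlingSecond (n - i) k := by
  have h := Nat.stirlingSecond_succ_succ_eq_sum_choose (n + 1) k
  rw [Finset.sum_range_succ', Nat.stirlingSecond_succ_succ] at h
  simpa using h

noncomputable section

/-- The surjection polynomial `∑ k, k! S(q,k) x ^ k`. -/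
def surjPoly (q : ℕ) (x : ℝ) : ℝ :=
  ∑ k ∈ Finset.range (q + 1), (k ! : ℝ) * (Nat.stirlingSecond q k : ℝ) * x ^ k

theorem surjPoly_zero (x : ℝ) : surjPoly 0 x = 1 := by simp [surjPoly]

theorem surjPoly_eq_sum_range {q N : ℕ} (h : q < N) (x : ℝ) :
    surjPoly q x =
      ∑ k ∈ Finset.range N, (k ! : ℝ) * (Nat.stirlingSecond q k : ℝ) * x ^ k := by
  refine Finset.sum_subset (Finset.range_subset_range.2 h) fun k _ hk => ?_
  rw [Nat.stirlingSecond_eq_zero_of_lt (by simpa using hk)]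
  simp

theorem eulerP_succ_eq_sum_range (q : ℕ) (x : ℝ) :
    eulerP (q + 1) x = ∑ k ∈ Finset.range (q + 1),
      ((k + 1)! : ℝ) * (Nat.stirlingSecond (q + 1) (k + 1) : ℝ) * x ^ k := by
  rw [eulerP, Finset.range_eq_Ico]
  exact (Finset.sum_Ico_add' (fun k =>
    (k ! : ℝ) * (Nat.stirlingSecond (q + 1) k : ℝ) * x ^ (k - 1)) 0 (q + 1) 1).symm

theorem surjPoly_succ (q : ℕ) (x : ℝ) : surjPoly (q + 1) x = x * eulerP (q + 1) x := by
  rw [surjPoly, Finset.sum_range_succ', eulerP_succ_eq_sum_range, Finset.mul_sum]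
  simp only [Nat.stirlingSecond_succ_zero, Nat.cast_zero, mul_zero, zero_mul, add_zero]
  refine Finset.sum_congr rfl fun k _ => ?_
  ring

theorem surjPoly_of_pos {q : ℕ} (hq : 0 < q) (x : ℝ) : surjPoly q x = x * eulerP q x := by
  obtain ⟨q, rfl⟩ := Nat.exists_eq_add_of_le' hq
  exact surjPoly_succ q x

/-- Splits off the first block, of size `r + 1`, of an ordered set partition; its factor `x` is the
one that `eulerP` lacks compared with `surjPoly`. -/
theorem eulerP_succ (n : ℕ) (x : ℝ) :
    eulerP (n + 1) x =
      ∑ r ∈ Finset.range (n + 1), ((n + 1).choose (r + 1) : ℝ) * surjPoly (n - r) x := by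
  have h1 : ∀ r ∈ Finset.range (n + 1), ((n + 1).choose (r + 1) : ℝ) * surjPoly (n - r) x =
      ∑ k ∈ Finset.range (n + 1), ((n + 1).choose (r + 1) : ℝ) *
        ((k ! : ℝ) * (Nat.stirlingSecond (n - r) k : ℝ) * x ^ k) := by
    intro r _
    rw [surjPoly_eq_sum_range (Nat.lt_succ_of_le (Nat.sub_le n r)), Finset.mul_sum]
  rw [Finset.sum_congr rfl h1, Finset.sum_comm, eulerP_succ_eq_sum_range]
  refine Finset.sum_congr rfl fun k _ => ?_
  have h2 : ((k : ℝ) + 1) * (Nat.stirlingSecond (n + 1) (k + 1) : ℝ) =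
      ∑ i ∈ Finset.range (n + 1),
        ((n + 1).choose (i + 1) : ℝ) * (Nat.stirlingSecond (n - i) k : ℝ) := by
    exact_mod_cast Nat.succ_mul_stirlingSecond_succ n k
  rw [Nat.factorial_succ, Nat.cast_mul, Nat.cast_succ, mul_comm ((k : ℝ) + 1), mul_assoc (k ! : ℝ),
    h2, Finset.mul_sum, Finset.sum_mul]
  refine Finset.sum_congr rfl fun i _ => ?_
  ring

/-- The recursion encoded by the exponential generating function `1 / (1 - x (e^t - 1))`. -/
theorem surjPoly_succ_div_factorial (n : ℕ) (x : ℝ) :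
    surjPoly (n + 1) x / (n + 1)! =
      x * ∑ r ∈ Finset.range (n + 1), 1 / ((r + 1)! : ℝ) * (surjPoly (n - r) x / (n - r)!) := by
  rw [surjPoly_succ, eulerP_succ, mul_div_assoc, Finset.sum_div]
  congr 1
  refine Finset.sum_congr rfl fun r hr => ?_
  have hr' : r + 1 ≤ n + 1 := by simpa [Nat.lt_succ_iff] using hr
  rw [Nat.cast_choose ℝ hr', Nat.add_sub_add_right]
  have h1 : ((n + 1)! : ℝ) ≠ 0 := by positivity
  have h2 : ((r + 1)! : ℝ) ≠ 0 := by positivity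
  have h3 : ((n - r)! : ℝ) ≠ 0 := by positivity
  field_simp

/-! ### Descents and ascents -/

section DesAsc

variable {α β : Type*} [LinearOrder α] [LinearOrder β]

theorem natCard_subtype_succ_lt {m : ℕ} (p : Fin (m + 1) → Fin (m + 1) → Prop)
    [DecidableRel p] :
    Nat.card {j : Fin (m + 1) // ∃ h : (j : ℕ) + 1 < m + 1, p j ⟨j + 1, h⟩} =
      ∑ j : Fin m, if p j.castSucc j.succ then 1 else 0 := by
  classical
  rw [Nat.card_eq_fintype_card, Fintype.card_subtype, Finset.card_filter, Fin.sum_univ_castSucc]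
  simp only [Fin.val_last, lt_self_iff_false, IsEmpty.exists_iff, if_false, add_zero]
  refine Finset.sum_congr rfl fun j _ => ?_
  have : (∃ h : (j.castSucc : ℕ) + 1 < m + 1, p j.castSucc ⟨j.castSucc + 1, h⟩) ↔
      p j.castSucc j.succ :=
    ⟨fun ⟨_, h⟩ => h, fun h => ⟨by simp, h⟩⟩
  simp only [this]

theorem des_eq_sum {m : ℕ} (i : Fin (m + 1) → α) :
    des i = ∑ j : Fin m, if i j.succ < i j.castSucc then 1 else 0 :=
  natCard_subtype_succ_lt fun j k => i k < i j

theorem asc_eq_sum {m : ℕ} (i : Fin (m + 1) → α) :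
    asc i = ∑ j : Fin m, if i j.castSucc < i j.succ then 1 else 0 :=
  natCard_subtype_succ_lt fun j k => i j < i k

theorem des_fin_one (i : Fin 1 → α) : des i = 0 := by simp [des_eq_sum]

theorem asc_fin_one (i : Fin 1 → α) : asc i = 0 := by simp [asc_eq_sum]

theorem des_succ_succ {m : ℕ} (i : Fin (m + 2) → α) :
    des i = (if i 1 < i 0 then 1 else 0) + des (fun j : Fin (m + 1) => i j.succ) := by
  rw [des_eq_sum, des_eq_sum, Fin.sum_univ_succ]
  rfl

theorem asc_succ_succ {m : ℕ} (i : Fin (m + 2) → α) :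
    asc i = (if i 0 < i 1 then 1 else 0) + asc (fun j : Fin (m + 1) => i j.succ) := by
  rw [asc_eq_sum, asc_eq_sum, Fin.sum_univ_succ]
  rfl

theorem des_comp_strictMono {m : ℕ} {f : α → β} (hf : StrictMono f) (i : Fin m → α) :
    des (fun j => f (i j)) = des i := by
  simp only [des, hf.lt_iff_lt]

theorem asc_comp_strictMono {m : ℕ} {f : α → β} (hf : StrictMono f) (i : Fin m → α) :
    asc (fun j => f (i j)) = asc i := by
  simp only [asc, hf.lt_iff_lt]

end DesAsc

/-! ### Homogeneous Eulerian polynomials -/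

/-- The permutation with first value `p` whose remaining values are ordered as those of `τ`. -/
def permCons {n : ℕ} (p : Fin (n + 1)) (τ : Equiv.Perm (Fin n)) : Equiv.Perm (Fin (n + 1)) :=
  (Equiv.Perm.decomposeFin.symm (0, τ)).trans p.cycleRange.symm

theorem permCons_zero {n : ℕ} (p : Fin (n + 1)) (τ : Equiv.Perm (Fin n)) :
    permCons p τ 0 = p := by
  cases n with
  | zero => exact Subsingleton.elim (α := Fin 1) _ _
  | succ n => simp [permCons]

theorem permCons_succ {n : ℕ} (p : Fin (n + 1)) (τ : Equiv.Perm (Fin n)) (j : Fin n) :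
    permCons p τ j.succ = p.succAbove (τ j) := by
  simp [permCons]

theorem permCons_bijective (n : ℕ) :
    Function.Bijective fun z : Fin (n + 1) × Equiv.Perm (Fin n) => permCons z.1 z.2 := by
  rw [Fintype.bijective_iff_injective_and_card]
  constructor
  · rintro ⟨p, τ⟩ ⟨p', τ'⟩ h
    have hp : p = p' := by
      have := congrArg (fun σ => σ 0) h
      simpa only [permCons_zero] using this
    subst hp
    congr 1
    ext j
    have := congrArg (fun σ => σ j.succ) h
    simp only [permCons_succ] at this
    rw [Fin.succAbove_right_injective this]
  · simp [Fintype.card_perm, Nat.factorial_succ]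

theorem sum_perm_succ {n : ℕ} {M : Type*} [AddCommMonoid M]
    (F : Equiv.Perm (Fin (n + 1)) → M) :
    ∑ σ, F σ = ∑ p, ∑ τ, F (permCons p τ) := by
  rw [← Fintype.sum_prod_type']
  exact ((permCons_bijective n).sum_comp F).symm

theorem des_permCons {n : ℕ} (p : Fin (n + 2)) (τ : Equiv.Perm (Fin (n + 1))) :
    des (permCons p τ) = (if (τ 0 : ℕ) < p then 1 else 0) + des τ := by
  have h1 : permCons p τ 1 = p.succAbove (τ 0) := permCons_succ p τ 0
  rw [des_succ_succ, h1, permCons_zero, ← des_comp_strictMono p.strictMono_succAbove τ]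
  simp only [permCons_succ, Fin.succAbove_lt_iff_castSucc_lt]
  simp only [Fin.lt_def, Fin.val_castSucc]

theorem asc_permCons {n : ℕ} (p : Fin (n + 2)) (τ : Equiv.Perm (Fin (n + 1))) :
    asc (permCons p τ) = (if (τ 0 : ℕ) < p then 0 else 1) + asc τ := by
  have h1 : permCons p τ 1 = p.succAbove (τ 0) := permCons_succ p τ 0
  rw [asc_succ_succ, h1, permCons_zero, ← asc_comp_strictMono p.strictMono_succAbove τ]
  simp only [permCons_succ, Fin.lt_succAbove_iff_le_castSucc]
  simp only [Fin.le_def, Fin.val_castSucc]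
  congr 1
  split_ifs <;> omega

/-- The part of the Eulerian sum coming from permutations with first value `p`. -/
def homEulerianFirst {n : ℕ} (p : Fin (n + 1)) (x y : ℝ) : ℝ :=
  ∑ τ : Equiv.Perm (Fin n), x ^ des (permCons p τ) * y ^ asc (permCons p τ)

theorem homEulerian_succ (n : ℕ) (x y : ℝ) :
    homEulerian (n + 1) x y = ∑ p : Fin (n + 1), homEulerianFirst p x y :=
  sum_perm_succ _

/-- Only the comparison of `p` with the next relative value `i` is new: a descent when `i < p`, an
ascent otherwise. -/
theorem homEulerianFirst_succ {n : ℕ} (p : Fin (n + 2)) (x y : ℝ) :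
    homEulerianFirst p x y =
      ∑ i : Fin (n + 1), (if (i : ℕ) < p then x else y) * homEulerianFirst i x y := by
  rw [homEulerianFirst, sum_perm_succ]
  refine Finset.sum_congr rfl fun i _ => ?_
  rw [homEulerianFirst, Finset.mul_sum]
  refine Finset.sum_congr rfl fun τ _ => ?_
  rw [des_permCons, asc_permCons, permCons_zero]
  split_ifs <;> ring

/-- The hockey-stick identity. -/
theorem sum_range_ite_le_choose (N j r : ℕ) (hj : j ≤ N) :
    ∑ i ∈ Finset.range N, (if j ≤ i then (N - 1 - i).choose r else 0) =
      (N - j).choose (r + 1) := by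
  induction N generalizing j with
  | zero => simp
  | succ N ih =>
    rw [Finset.sum_range_succ']
    cases j with
    | zero =>
      have := ih 0 (Nat.zero_le _)
      simp only [Nat.zero_le, if_true, Nat.sub_zero] at this ⊢
      rw [Nat.choose_succ_succ, ← this, add_comm]
      congr 1
      refine Finset.sum_congr rfl fun i _ => ?_
      congr 1
      omega
    | succ j =>
      have := ih j (by omega)
      simp only [add_le_add_iff_right, Nat.add_sub_add_right, nonpos_iff_eq_zero,
        Nat.succ_ne_zero, if_false, add_zero]
      rw [← this]
      refine Finset.sum_congr rfl fun i _ => ?_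
      congr 2
      omega

theorem sum_fin_ite_choose (n j : ℕ) (hj : j ≤ n + 1) (G : ℕ → ℝ) :
    ∑ i : Fin (n + 1), (if (i : ℕ) < j then 0 else
        ∑ r ∈ Finset.range (n + 1), ((n - i).choose r : ℝ) * G r) =
      ∑ r ∈ Finset.range (n + 1), ((n + 1 - j).choose (r + 1) : ℝ) * G r := by
  rw [Fin.sum_univ_eq_sum_range (fun i => if i < j then 0 else
        ∑ r ∈ Finset.range (n + 1), ((n - i).choose r : ℝ) * G r) (n + 1)]
  have h : ∀ i, (if i < j then 0 else
        ∑ r ∈ Finset.range (n + 1), ((n - i).choose r : ℝ) * G r) =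
      ∑ r ∈ Finset.range (n + 1), ((if j ≤ i then (n - i).choose r else 0 : ℕ) : ℝ) * G r := by
    intro i
    by_cases hi : i < j
    · simp [hi, Nat.not_le.2 hi]
    · simp [hi, Nat.not_lt.1 hi]
  simp only [h]
  rw [Finset.sum_comm]
  refine Finset.sum_congr rfl fun r _ => ?_
  rw [← Finset.sum_mul, ← Nat.cast_sum, ← sum_range_ite_le_choose (n + 1) j r hj]
  rfl

/-- With `y = x + 1` the recursion gives `x` times the full sum plus the part with `i ≥ p`. The
former is `surjPoly (n + 1) x`, the term `r = 0`; the hockey-stick identity turns the latter into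
the terms `r ≥ 1`. -/
theorem homEulerianFirst_eq {n : ℕ} (p : Fin (n + 1)) (x : ℝ) :
    homEulerianFirst p x (x + 1) =
      ∑ r ∈ Finset.range (n + 1), ((n - p).choose r : ℝ) * surjPoly (n - r) x := by
  induction n with
  | zero => simp [homEulerianFirst, surjPoly_zero, des_fin_one, asc_fin_one]
  | succ n ih =>
    have hsum : ∑ i : Fin (n + 1), homEulerianFirst i x (x + 1) = eulerP (n + 1) x := by
      have := sum_fin_ite_choose n 0 (Nat.zero_le _) fun r => surjPoly (n - r) x
      simp only [Nat.not_lt_zero, if_false, Nat.sub_zero] at this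
      rw [eulerP_succ, ← this]
      exact Finset.sum_congr rfl fun i _ => ih i
    have hterm : ∀ i : Fin (n + 1),
        (if (i : ℕ) < p then x else x + 1) * homEulerianFirst i x (x + 1) =
        x * homEulerianFirst i x (x + 1) + if (i : ℕ) < p then 0 else
          ∑ r ∈ Finset.range (n + 1), ((n - i).choose r : ℝ) * surjPoly (n - r) x := by
      intro i
      rw [← ih i]
      split_ifs <;> ring
    rw [homEulerianFirst_succ, Finset.sum_congr rfl fun i _ => hterm i, Finset.sum_add_distrib,
      ← Finset.mul_sum, hsum, ← surjPoly_succ,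
      sum_fin_ite_choose n p (Nat.lt_succ_iff.1 p.2) fun r => surjPoly (n - r) x,
      Finset.sum_range_succ' _ (n + 1)]
    simp [add_comm]

theorem eulerP_eq_homEulerian {q : ℕ} (hq : 0 < q) (x : ℝ) :
    eulerP q x = homEulerian q x (x + 1) := by
  obtain ⟨n, rfl⟩ := Nat.exists_eq_add_of_le' hq
  have := sum_fin_ite_choose n 0 (Nat.zero_le _) fun r => surjPoly (n - r) x
  simp only [Nat.not_lt_zero, if_false, Nat.sub_zero] at this
  rw [homEulerian_succ, eulerP_succ, ← this]
  exact Finset.sum_congr rfl fun i _ => (homEulerianFirst_eq i x).symm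

end

/-! ### Logarithm, resolvent and exponential of noncommutative series -/

noncomputable section

namespace NCSeries

variable {A R K : Type*}

section Ring

variable [Ring R]

theorem coeff_sub (w : FreeMonoid A) (f g : NCSeries A R) :
    coeff w (f - g) = coeff w f - coeff w g := rfl

theorem coeff_one_one : coeff (1 : FreeMonoid A) (1 : NCSeries A R) = 1 := by
  simp [coeff_one]

theorem coeff_pow_eq_zero_of_length_lt {g : NCSeries A R} (hg : coeff 1 g = 0) {k : ℕ}
    {w : FreeMonoid A} (hw : w.toList.length < k) : coeff w (g ^ k) = 0 := by
  induction k generalizing w with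
  | zero => omega
  | succ k ih =>
    rw [pow_succ', coeff_mul]
    refine Finset.sum_eq_zero fun j hj => ?_
    rcases Nat.eq_zero_or_pos j with rfl | hj0
    · have : coeff (FreeMonoid.ofList (w.toList.take 0)) g = 0 := hg
      rw [this, zero_mul]
    · rw [ih, mul_zero]
      simp only [Finset.mem_range] at hj
      simp only [FreeMonoid.toList_ofList, List.length_drop]
      omega

/-- The resolvent `∑ k, x ^ k g ^ k = (1 - x g)⁻¹` of a series `g` without constant term. -/
def resolvent (x : R) (g : NCSeries A R) : NCSeries A R :=
  fun w => ∑ k ∈ Finset.range (w.toList.length + 1), x ^ k * coeff w (g ^ k)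

theorem coeff_resolvent {g : NCSeries A R} (hg : coeff 1 g = 0) (x : R) {w : FreeMonoid A} {N : ℕ}
    (hN : w.toList.length < N) :
    coeff w (resolvent x g) = ∑ k ∈ Finset.range N, x ^ k * coeff w (g ^ k) := by
  refine Finset.sum_subset (Finset.range_subset_range.2 hN) fun k _ hk => ?_
  rw [coeff_pow_eq_zero_of_length_lt hg (by simpa using hk), mul_zero]

theorem coeff_one_resolvent (x : R) (g : NCSeries A R) : coeff 1 (resolvent x g) = 1 := by
  have : coeff 1 (resolvent x g) = ∑ k ∈ Finset.range 1, x ^ k * coeff 1 (g ^ k) := rfl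
  rw [this]
  simp [coeff_one_one]

end Ring

theorem coeff_resolvent_eq [CommRing R] {g : NCSeries A R} (hg : coeff 1 g = 0) (x : R)
    (w : FreeMonoid A) :
    coeff w (resolvent x g) = coeff w 1 + x * coeff w (g * resolvent x g) := by
  have h1 : coeff w (g * resolvent x g) =
      ∑ k ∈ Finset.range (w.toList.length + 1), x ^ k * coeff w (g ^ (k + 1)) := by
    simp only [pow_succ', coeff_mul w, Finset.mul_sum]
    rw [Finset.sum_comm]
    refine Finset.sum_congr rfl fun j _ => ?_
    rw [coeff_resolvent hg x (N := w.toList.length + 1), Finset.mul_sum]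
    · refine Finset.sum_congr rfl fun k _ => ?_
      ring
    · simp only [FreeMonoid.toList_ofList, List.length_drop]
      omega
  rw [h1, coeff_resolvent hg x (N := w.toList.length + 2) (by omega), Finset.sum_range_succ',
    pow_zero, pow_zero, one_mul, add_comm, Finset.mul_sum]
  congr 1
  refine Finset.sum_congr rfl fun k _ => ?_
  ring

/-- A rearrangement of `H = 1 + x (f - 1) H`; the constant `1` is invisible at nonempty words. -/
theorem mul_coeff_mul_resolvent_sub_one [CommRing R] {f : NCSeries A R} (hf : coeff 1 f = 1)
    (x : R) {w : FreeMonoid A} (hw : w ≠ 1) :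
    x * coeff w (f * resolvent x (f - 1)) = (1 + x) * coeff w (resolvent x (f - 1)) := by
  have hg : coeff 1 (f - 1) = 0 := by rw [coeff_sub, hf, coeff_one_one, sub_self]
  have h := coeff_resolvent_eq hg x w
  rw [coeff_one, if_neg hw, sub_mul, one_mul, coeff_sub] at h
  linear_combination -h

/-! ### The logarithm as an integral of the resolvent -/

variable [Field K]

theorem coeff_log_eq_sum {f : NCSeries A K} (hf : coeff 1 f = 1) (w : FreeMonoid A) :
    coeff w (log f) = ∑ k ∈ Finset.range w.toList.length,
      ((-1) ^ k / ((k : K) + 1)) * coeff w ((f - 1) ^ (k + 1)) := by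
  have hg : coeff 1 (f - 1) = 0 := by rw [coeff_sub, hf, coeff_one_one, sub_self]
  refine finsum_eq_sum_of_support_subset _ fun k hk => ?_
  by_contra hk'
  refine hk ?_
  change ((-1) ^ k / ((k : K) + 1)) * coeff w ((f - 1) ^ (k + 1)) = 0
  simp only [Finset.coe_range, Set.mem_Iio, not_lt] at hk'
  rw [coeff_pow_eq_zero_of_length_lt hg (by omega), mul_zero]

theorem coeff_log_eq_integral {f : NCSeries A ℂ} (hf : coeff 1 f = 1) {w : FreeMonoid A}
    (hw : w ≠ 1) (u : ℝ → ℝ)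
    (hu : ∀ x : ℝ, coeff w (resolvent (x : ℂ) (f - 1)) = ((x * u x : ℝ) : ℂ)) :
    coeff w (log f) = ((∫ x in (-1 : ℝ)..0, u x : ℝ) : ℂ) := by
  have hg : coeff 1 (f - 1) = 0 := by rw [coeff_sub, hf, coeff_one_one, sub_self]
  rw [coeff_log_eq_sum hf, ← intervalIntegral.integral_ofReal]
  have h1 : ∫ x in (-1 : ℝ)..0, ((u x : ℝ) : ℂ) = ∫ x in (-1 : ℝ)..0,
      ∑ k ∈ Finset.range w.toList.length, coeff w ((f - 1) ^ (k + 1)) * ((x ^ k : ℝ) : ℂ) := by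
    -- The open interval excludes `x = 0`, so `x` can be cancelled in `hu`.
    refine intervalIntegral.integral_congr_Ioo_of_le (by norm_num) fun x hx => ?_
    have hx0 : (x : ℂ) ≠ 0 := by exact_mod_cast hx.2.ne
    have h := hu x
    rw [coeff_resolvent hg _ (Nat.lt_succ_self _), Finset.sum_range_succ', pow_zero, pow_zero,
      coeff_one, if_neg hw, mul_zero, add_zero] at h
    refine mul_left_cancel₀ hx0 ?_
    rw [← Complex.ofReal_mul, ← h, Finset.mul_sum]
    refine Finset.sum_congr rfl fun k _ => ?_
    push_cast
    ring
  rw [h1, intervalIntegral.integral_finsetSum]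
  · refine Finset.sum_congr rfl fun k _ => ?_
    rw [intervalIntegral.integral_const_mul, intervalIntegral.integral_ofReal, integral_pow,
      mul_comm]
    congr 1
    push_cast
    rw [zero_pow (Nat.succ_ne_zero k), pow_succ]
    ring
  · intro k _
    exact Continuous.intervalIntegrable (by fun_prop) _ _

/-! ### Coefficients of the exponential of a letter -/

theorem coeff_one_letter (a : A) : coeff 1 (letter K a) = 0 :=
  if_neg (FreeMonoid.of_ne_one a).symm

open Classical in
theorem tail_letter (a b : A) : tail b (letter K a) = if b = a then 1 else 0 := by
  ext w
  have h : coeff w (tail b (letter K a)) =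
      if FreeMonoid.of b * w = FreeMonoid.of a then 1 else 0 := rfl
  have h' : FreeMonoid.of b * w = FreeMonoid.of a ↔ b = a ∧ w = 1 := by
    have : FreeMonoid.of b * w = FreeMonoid.of a ↔ b :: w.toList = [a] := Iff.rfl
    rw [this, List.cons_eq_cons]
    rfl
  rw [h]
  simp only [h']
  by_cases hb : b = a
  · simp [hb, coeff_one]
  · simp [hb, coeff_zero]

open Classical in
theorem coeff_letter_pow (a : A) (k : ℕ) (w : FreeMonoid A) :
    coeff w (letter K a ^ k) = if w.toList = List.replicate k a then 1 else 0 := by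
  induction k generalizing w with
  | zero =>
    rw [pow_zero]
    exact if_congr Iff.rfl rfl rfl
  | succ k ih =>
    cases w using FreeMonoid.casesOn with
    | one =>
      rw [pow_succ', coeff_empty_mul, coeff_one_letter, zero_mul, if_neg]
      simp [List.replicate_succ]
    | of_mul b w =>
      rw [pow_succ', coeff_of_mul_mul, coeff_one_letter, zero_mul, zero_add, tail_letter]
      by_cases hb : b = a
      · simp [hb, ih, List.replicate_succ]
      · simp [hb, coeff_zero, List.replicate_succ]

open Classical in
theorem coeff_exp_letter (a : A) (w : FreeMonoid A) :
    coeff w (exp (letter K a)) =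
      if ∀ b ∈ w.toList, b = a then 1 / (w.toList.length ! : K) else 0 := by
  have h : coeff w (exp (letter K a)) =
    ∑ᶠ k : ℕ, (1 / (k ! : K)) * coeff w (letter K a ^ k) := rfl
  rw [h, finsum_eq_single _ w.toList.length]
  · rw [coeff_letter_pow]
    simp [List.eq_replicate_iff]
  · intro k hk
    rw [coeff_letter_pow, if_neg, mul_zero]
    intro hw
    exact hk (by rw [hw, List.length_replicate])

theorem coeff_one_exp_letter (a : A) : coeff 1 (exp (letter K a)) = 1 := by
  rw [coeff_exp_letter, if_pos (by simp)]
  simp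

theorem coeff_exp_letter_replicate (a : A) (r : ℕ) :
    coeff (FreeMonoid.ofList (List.replicate r a)) (exp (letter K a)) = 1 / (r ! : K) := by
  rw [coeff_exp_letter, if_pos (by intro b hb; exact List.eq_of_mem_replicate hb),
    FreeMonoid.toList_ofList, List.length_replicate]

/-- A prefix longer than `q` contains the head of `v`, which is not `a`, so `e^a` has coefficient
zero there. -/
theorem coeff_exp_letter_mul (a : A) (F : NCSeries A K) (q : ℕ) {v : List A}
    (hv : v.head? ≠ some a) :
    coeff (FreeMonoid.ofList (List.replicate q a ++ v)) (exp (letter K a) * F) =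
      ∑ r ∈ Finset.range (q + 1), 1 / (r ! : K) *
        coeff (FreeMonoid.ofList (List.replicate (q - r) a ++ v)) F := by
  rw [coeff_mul, FreeMonoid.toList_ofList, List.length_append, List.length_replicate]
  symm
  have hsub : Finset.range (q + 1) ⊆ Finset.range (q + v.length + 1) :=
    Finset.range_subset_range.2 (by omega)
  rw [← Finset.sum_subset hsub]
  · refine Finset.sum_congr rfl fun r hr => ?_
    have hr' : r ≤ q := by simpa [Nat.lt_succ_iff] using hr
    rw [List.take_append_of_le_length (by simpa using hr'),
      List.drop_append_of_le_length (by simpa using hr'), List.take_replicate,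
      List.drop_replicate, min_eq_left hr', coeff_exp_letter_replicate]
  · intro r hr hr'
    rw [coeff_exp_letter, if_neg, zero_mul]
    simp only [Finset.mem_range] at hr hr'
    intro h
    cases v with
    | nil => simp at hr; omega
    | cons b v =>
      refine hv ?_
      rw [List.head?_cons, h b]
      obtain ⟨s, hs⟩ : ∃ s, r - q = s + 1 := ⟨r - q - 1, by omega⟩
      simp [List.take_append, hs]

end NCSeries

end

/-! ### Products of exponentials of distinct letters -/

noncomputable section

namespace NCSeries

variable {A K : Type*} [Field K] {n : ℕ}

/-- The product `e^{a_k} ⋯ e^{a_{n-1}}`. -/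
def expTail (K : Type*) [Field K] (a : Fin n → A) (k : ℕ) : NCSeries A K :=
  ((List.ofFn fun k => exp (letter K (a k))).drop k).prod

theorem expTail_zero (a : Fin n → A) :
    expTail K a 0 = (List.ofFn fun k => exp (letter K (a k))).prod := rfl

theorem expTail_last (a : Fin n → A) : expTail K a n = 1 := by
  rw [expTail, List.drop_of_length_le (by simp), List.prod_nil]

theorem expTail_eq_mul (a : Fin n → A) {k : ℕ} (hk : k < n) :
    expTail K a k = exp (letter K (a ⟨k, hk⟩)) * expTail K a (k + 1) := by
  rw [expTail, List.drop_eq_getElem_cons (by simpa using hk), List.prod_cons, List.getElem_ofFn,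
    expTail]

theorem coeff_one_expTail (a : Fin n → A) (k : ℕ) : coeff 1 (expTail K a k) = 1 := by
  have h : ∀ l : List (NCSeries A K), (∀ f ∈ l, coeff 1 f = 1) → coeff 1 l.prod = 1 := by
    intro l hl
    induction l with
    | nil => rw [List.prod_nil, coeff_one_one]
    | cons f l ih =>
      rw [List.prod_cons, coeff_empty_mul, hl f (by simp),
        ih fun g hg => hl g (List.mem_cons_of_mem _ hg), one_mul]
  refine h _ fun f hf => ?_
  obtain ⟨j, rfl⟩ := (List.mem_ofFn' _ _).1 (List.mem_of_mem_drop hf)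
  exact coeff_one_exp_letter _

theorem coeff_expTail_mul_congr (a : Fin n → A) (F : NCSeries A K) {s t : ℕ} (hst : s ≤ t)
    (ht : t ≤ n) {v : List A} (hv : ∀ k : Fin n, s ≤ k → (k : ℕ) < t → v.head? ≠ some (a k)) :
    coeff (FreeMonoid.ofList v) (expTail K a s * F) =
      coeff (FreeMonoid.ofList v) (expTail K a t * F) := by
  induction t, hst using Nat.le_induction with
  | base => rfl
  | succ t hst ih =>
    -- With `q = 0` only the empty prefix contributes.
    have h := coeff_exp_letter_mul (a ⟨t, ht⟩) (expTail K a (t + 1) * F) 0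
      (hv ⟨t, ht⟩ hst (Nat.lt_succ_self t))
    rw [ih (by omega) fun k h1 h2 => hv k h1 (by omega), expTail_eq_mul a ht, mul_assoc']
    simpa using h

theorem coeff_replicate_append_resolvent {a : Fin n → A} (ha : Function.Injective a) (x : ℝ)
    (j : Fin n) {v : List A} (hv : v.head? ≠ some (a j)) {q : ℕ} (hq : 0 < q) :
    coeff (FreeMonoid.ofList (List.replicate q (a j) ++ v))
        (resolvent (x : ℂ) (expTail ℂ a 0 - 1)) =
      coeff (FreeMonoid.ofList v)
          (expTail ℂ a (j + 1) * resolvent (x : ℂ) (expTail ℂ a 0 - 1)) *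
        ((surjPoly q x / q ! : ℝ) : ℂ) := by
  set H := resolvent (x : ℂ) (expTail ℂ a 0 - 1) with hH
  -- For `s > 0` this is also the coefficient in `H` itself, but at `s = 0` the two may differ; the
  -- recursion needs this version.
  set h : ℕ → ℂ := fun s =>
    coeff (FreeMonoid.ofList (List.replicate s (a j) ++ v)) (expTail ℂ a (j + 1) * H) with hh
  have hhead : ∀ s, (List.replicate (s + 1) (a j) ++ v).head? = some (a j) := fun s => rfl
  have hpos : ∀ s, coeff (FreeMonoid.ofList (List.replicate (s + 1) (a j) ++ v)) H = h (s + 1) := by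
    intro s
    rw [hh]
    change _ = coeff _ _
    rw [coeff_expTail_mul_congr a H (Nat.succ_le_of_lt j.2) le_rfl, expTail_last, one_mul']
    intro k hk _
    rw [hhead]
    intro e
    have := ha (Option.some.inj e)
    subst this
    omega
  -- In `x ∑_{r ≥ 0} h (s + 1 - r) / r! = (1 + x) h (s + 1)` the term `r = 0` cancels `x h (s + 1)`.
  have hrec : ∀ s, h (s + 1) =
      x * ∑ r ∈ Finset.range (s + 1), 1 / ((r + 1)! : ℂ) * h (s - r) := by
    intro s
    have h1 := mul_coeff_mul_resolvent_sub_one (coeff_one_expTail a 0) (x : ℂ)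
      (w := FreeMonoid.ofList (List.replicate (s + 1) (a j) ++ v))
      (fun e => List.cons_ne_nil _ _ (congrArg FreeMonoid.toList e))
    rw [← hH, hpos, coeff_expTail_mul_congr a H (Nat.zero_le j) j.2.le, expTail_eq_mul a j.2,
      mul_assoc', coeff_exp_letter_mul _ _ _ hv, Finset.sum_range_succ'] at h1
    · have h2 : ∀ r ∈ Finset.range (s + 1), 1 / ((r + 1)! : ℂ) *
          coeff (FreeMonoid.ofList (List.replicate (s + 1 - (r + 1)) (a j) ++ v))
            (expTail ℂ a (j + 1) * H) = 1 / ((r + 1)! : ℂ) * h (s - r) := by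
        intro r _
        rw [Nat.add_sub_add_right]
      have h3 : coeff (FreeMonoid.ofList (List.replicate (s + 1 - 0) (a j) ++ v))
            (expTail ℂ a (j + 1) * H) = h (s + 1) := rfl
      erw [Finset.sum_congr rfl h2, h3] at h1
      simp only [Nat.factorial_zero, Nat.cast_one, div_one, one_mul] at h1
      linear_combination -h1
    · intro k _ hk
      rw [hhead]
      intro e
      have := ha (Option.some.inj e)
      subst this
      omega
  have hsol : ∀ s, h s = h 0 * ((surjPoly s x / s ! : ℝ) : ℂ) := by
    intro s
    induction s using Nat.strong_induction_on with
    | _ s ih =>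
      cases s with
      | zero => simp [surjPoly_zero]
      | succ s =>
        rw [hrec, surjPoly_succ_div_factorial]
        push_cast
        rw [Finset.mul_sum, Finset.mul_sum, Finset.mul_sum]
        refine Finset.sum_congr rfl fun r _ => ?_
        rw [ih (s - r) (by omega)]
        push_cast
        ring
  obtain ⟨q, rfl⟩ := Nat.exists_eq_add_of_le' hq
  rw [hpos, hsol]
  rfl

/-- The word `b_0^{q_0} ⋯ b_{m-1}^{q_{m-1}}` as a list. -/
def blockWord {m : ℕ} (b : Fin m → A) (q : Fin m → ℕ) : List A :=
  (List.ofFn fun j => List.replicate (q j) (b j)).flatten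

theorem ofList_blockWord {m : ℕ} (b : Fin m → A) (q : Fin m → ℕ) :
    FreeMonoid.ofList (blockWord b q) = (List.ofFn fun j => FreeMonoid.of (b j) ^ q j).prod := by
  have h : ∀ (k : ℕ) (c : A), FreeMonoid.ofList (List.replicate k c) = FreeMonoid.of c ^ k := by
    intro k c
    induction k with
    | zero => rfl
    | succ k ih => rw [pow_succ', ← ih]; rfl
  rw [blockWord, FreeMonoid.ofList_flatten, List.map_ofFn]
  congr 2
  funext j
  exact h _ _

theorem blockWord_succ {m : ℕ} (b : Fin (m + 1) → A) (q : Fin (m + 1) → ℕ) :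
    blockWord b q = List.replicate (q 0) (b 0) ++
      blockWord (fun j => b j.succ) (fun j => q j.succ) := by
  rw [blockWord, List.ofFn_succ, List.flatten_cons]
  rfl

theorem head?_blockWord {m : ℕ} (b : Fin (m + 1) → A) (q : Fin (m + 1) → ℕ) (hq : 0 < q 0) :
    (blockWord b q).head? = some (b 0) := by
  obtain ⟨k, hk⟩ := Nat.exists_eq_add_of_le' hq
  rw [blockWord_succ, hk]
  rfl

theorem coeff_blockWord_resolvent {a : Fin n → A} (ha : Function.Injective a) (x : ℝ)
    {m : ℕ} (i : Fin (m + 1) → Fin n) (q : Fin (m + 1) → ℕ) (hq : ∀ j, 0 < q j)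
    (hi : ∀ j : Fin m, i j.castSucc ≠ i j.succ) :
    coeff (FreeMonoid.ofList (blockWord (fun j => a (i j)) q))
        (resolvent (x : ℂ) (expTail ℂ a 0 - 1)) =
      ((x * (x ^ des i * (1 + x) ^ asc i * ∏ j, eulerP (q j) x / (q j)!) : ℝ) : ℂ) := by
  induction m with
  | zero =>
    have hnil : blockWord (fun j : Fin 0 => a (i j.succ)) (fun j => q j.succ) = [] := rfl
    have h1 : coeff (FreeMonoid.ofList []) (expTail ℂ a (i 0 + 1) *
        resolvent (x : ℂ) (expTail ℂ a 0 - 1)) = 1 := by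
      have : (FreeMonoid.ofList [] : FreeMonoid A) = 1 := rfl
      rw [this, coeff_empty_mul, coeff_one_expTail, coeff_one_resolvent, one_mul]
    rw [blockWord_succ, hnil, coeff_replicate_append_resolvent ha x (i 0) (by simp) (hq 0), h1,
      one_mul, surjPoly_of_pos (hq 0), des_fin_one, asc_fin_one]
    simp [mul_div_assoc]
  | succ m ih =>
    have hhead := head?_blockWord (fun j : Fin (m + 1) => a (i j.succ)) (fun j => q j.succ) (hq _)
    have ih' := ih (fun j => i j.succ) (fun j => q j.succ) (fun j => hq _) fun j => hi j.succ
    have h01 : i 0 ≠ i 1 := hi 0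
    rw [blockWord_succ, coeff_replicate_append_resolvent ha x (i 0) _ (hq 0),
      surjPoly_of_pos (hq 0), Fin.prod_univ_succ, des_succ_succ, asc_succ_succ]
    -- At an ascent, `e^{a_0} ⋯ e^{a_{i 0}}` is restored on the left and `x [v] f H = (1 + x) [v] H`
    -- applies. At a descent, all exponentials after `e^{a_{i 0}}` are dropped.
    · rcases lt_or_gt_of_ne h01 with hlt | hgt
      · have hne : FreeMonoid.ofList (blockWord (fun j : Fin (m + 1) => a (i j.succ))
            (fun j => q j.succ)) ≠ 1 := by
          intro e
          have e' : blockWord (fun j : Fin (m + 1) => a (i j.succ)) (fun j => q j.succ) = [] := e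
          rw [e'] at hhead
          simp at hhead
        have h2 := mul_coeff_mul_resolvent_sub_one (coeff_one_expTail a 0) (x : ℂ) hne
        rw [coeff_expTail_mul_congr a _ (Nat.zero_le (i 0 + 1)) (Nat.succ_le_of_lt (i 0).2),
          ih'] at h2
        · rw [if_neg hlt.not_gt, if_pos hlt, mul_div_assoc, Complex.ofReal_mul, ← mul_assoc,
            mul_comm _ (x : ℂ), h2]
          push_cast
          ring
        · intro k _ hk
          rw [hhead]
          intro e
          have := ha (Option.some.inj e)
          subst this
          have : ((i 0 : Fin n) : ℕ) < i 1 := hlt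
          have h' : ((i (Fin.succ 0) : Fin n) : ℕ) = i 1 := rfl
          omega
      · rw [coeff_expTail_mul_congr a _ (Nat.succ_le_of_lt (i 0).2) le_rfl, expTail_last, one_mul',
          ih', if_pos hgt, if_neg hgt.not_gt]
        · push_cast
          ring
        · intro k hk _
          rw [hhead]
          intro e
          have := ha (Option.some.inj e)
          subst this
          have : ((i 1 : Fin n) : ℕ) < i 0 := hgt
          have h' : ((i (Fin.succ 0) : Fin n) : ℕ) = i 1 := rfl
          omega
    · rw [hhead]
      exact fun e => h01 (ha (Option.some.inj e)).symm

end NCSeries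

end

theorem mainTheorem12 {A : Type*} {n m : ℕ} (a : Fin n → A) (ha : Function.Injective a)
    (hm : 0 < m) (i : Fin m → Fin n) (q : Fin m → ℕ) (hq : ∀ j, 0 < q j)
    (hi : ∀ (j : ℕ) (h : j + 1 < m), i ⟨j, Nat.lt_of_succ_lt h⟩ ≠ i ⟨j + 1, h⟩) :
    (∀ (j : Fin m) (x : ℝ), eulerP (q j) x = homEulerian (q j) x (x + 1)) ∧
    NCSeries.coeff (List.ofFn fun j => FreeMonoid.of (a (i j)) ^ q j).prod
        (NCSeries.log (List.ofFn fun k => NCSeries.exp (NCSeries.letter ℂ (a k))).prod) =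
      (((1 / ∏ j, ((q j) ! : ℝ)) *
        ∫ x in (-1 : ℝ)..0, x ^ des i * (1 + x) ^ asc i * ∏ j, eulerP (q j) x : ℝ) : ℂ) := by
  refine ⟨fun j x => eulerP_eq_homEulerian (hq j) x, ?_⟩
  obtain ⟨m, rfl⟩ := Nat.exists_eq_add_of_le' hm
  have hne : FreeMonoid.ofList (NCSeries.blockWord (fun j => a (i j)) q) ≠ 1 := by
    intro e
    have e' : NCSeries.blockWord (fun j => a (i j)) q = [] := e
    have hhead := NCSeries.head?_blockWord (fun j => a (i j)) q (hq 0)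
    rw [e'] at hhead
    simp at hhead
  rw [← NCSeries.ofList_blockWord (fun j => a (i j)) q, ← NCSeries.expTail_zero,
    NCSeries.coeff_log_eq_integral (NCSeries.coeff_one_expTail a 0) hne _ fun x =>
      NCSeries.coeff_blockWord_resolvent ha x i q hq fun j => hi j (by omega),
    ← intervalIntegral.integral_const_mul]
  congr 2
  funext x
  rw [Finset.prod_div_distrib]
  ring
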